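/- A pre-Kleene algebra is an idempotent semiring with a unary operation ${}^*$ satisfying $x^* = 1 + x x^*$, ordered by $x \le y \iff x + y = y$. A commutable set is a set with a reflexive symmetric relation $\sim$; $\mathcal{S}X$ is the monoid of strings over $X$ modulo swapping adjacent commuting symbols, and $\mathcal{T}X$ is the free pre-Kleene algebra over $X$ (so $xy = yx$ in $\mathcal{T}X$ whenever $x \sim y$); its elements are called terms. Strings are viewed as terms, and a finite set of strings as the sum of its elements. Let $\Sigma$ be a finite commutable set, and let $\ddot\Sigma = \Sigma \oplus \Sigma$ consist of two copies $x_l$, $x_r$ of each symbol $x$, where $x_l \sim y_r$ for all $x, y$, and $x_l \sim y_l$, $x_r \sim y_r$ whenever $x \sim y$. Write $(-)_l, (-)_r$ for the two embeddings of strings and of terms, and $\pi_l, \pi_r$ for the projections (morphisms erasing the right, respectively left, symbols). A term over $\Sigma$ is viewed as a term over $\ddot\Sigma$ by mapping each symbol $x$ to $x_l x_r$; $\Sigma^{\neq} = \sum_{x \neq y} x_l y_r$. For $e \in \mathcal{T}\ddot\Sigma$ and $\Lambda \subseteq \mathcal{S}\Sigma$, let $\mathrm{Next}_e(\Lambda)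 = \{ s' \mid \exists s \in \Lambda,\ s_l s'_r \le e\}$. A term $L \in \mathcal{T}\Sigma$ is prefix free if for all strings $s_1, s_2 \le L$, whenever $s_1$ is a prefix of $s_2$ (that is, $s_2 = s_1 u$ for some string $u$), $s_1 = s_2$. For finite $X$, let $[-]_0 : \mathcal{T}X \to \{0,1\}$ be the morphism to the Boolean algebra that sends every symbol to $0$; a family $(\delta_x)_{x \in X}$ of terms is a family of derivatives of $e\in\mathcal{T}X$ if $e = [e]_0 + \sum_{x} x\,\delta_x$. A finite-state automaton is a finite set $S \subseteq \mathcal{T}X$ that contains $1$, is closed under finite sums (including the empty sum $0$), and such that every $e \in S$ has a family of derivatives in $S$; a term is finite-state if it belongs to some finite-state automaton. A term $e \in \mathcal{T}\ddot\Sigma$ has bounded output if there is $k \in \mathbb{N}$ with $|\pi_r(s)| \le (|\pi_l(s)| + 1)k$ for every string $s \le e$, where $|\cdot|$ is the length of a string. Lemma. Let $L \in \mathcal{T}\Sigma$ be prefix free, and let $e \in \mathcal{T}\ddot\Sigma$ satisfy $\pi_l(e) \le L$ and $\pi_r(e) \le L$. Suppose that $e$ is finite-state and has bounded output. Then $e$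 is a representable relation on $L$; that is: $\pi_l(e) \le L$ and $\pi_r(e) \le L$; $\mathrm{Next}_e(\Lambda)$ is finite for every finite set of strings $\Lambda \subseteq \mathcal{S}\Sigma$; and there is a term $\rho \in \mathcal{T}\ddot\Sigma$ such that, for every finite set of strings $\Lambda \subseteq \mathcal{S}\Sigma$ with $s \le L$ for all $s \in \Lambda$, $$\Lambda_r\, e \;\le\; \Lambda\, \mathrm{Next}_e(\Lambda)_r + \Sigma^* \Sigma^{\neq} \rho .$$ -/

import Mathlib

namespace PreKA

/-! ### Pre-Kleene algebras -/

/-- A (left-biased) pre-Kleene algebra: an idempotent semiring with a star operation that satisfies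
left unfolding. The order is `a ≤ b ↔ a + b = b`. -/
class PreKleeneAlgebra (α : Type*) extends IdemSemiring α, KStar α where
  kstar_unfold : ∀ a : α, KStar.kstar a = 1 + a * KStar.kstar a

/-- Morphisms of pre-Kleene algebras: maps that commute with all the operations. -/
structure PreKleeneHom (α β : Type*) [PreKleeneAlgebra α] [PreKleeneAlgebra β]
    extends α →+* β where
  map_kstar' : ∀ a : α, toFun (KStar.kstar a) = KStar.kstar (toFun a)

instance {α β : Type*} [PreKleeneAlgebra α] [PreKleeneAlgebra β] :
    CoeFun (PreKleeneHom α β) (fun _ => α → β) where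
  coe f := f.toRingHom

/-- The two-element algebra of booleans, with disjunction as sum and conjunction as product. -/
inductive Two : Type
  | zero
  | one
  deriving DecidableEq

namespace Two

instance : Fintype Two := ⟨{Two.zero, Two.one}, by intro x; cases x <;> decide⟩

instance : Zero Two := ⟨Two.zero⟩
instance : One Two := ⟨Two.one⟩

instance : Add Two where
  add
    | Two.zero, b => b
    | Two.one, _ => Two.one

instance : Mul Two where
  mul
    | Two.zero, _ => Two.zero
    | Two.one, b => b

instance : Semiring Two where
  add_assoc := by decide
  zero_add := by decide
  add_zero := by decide
  add_comm := by decide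
  mul_assoc := by decide
  one_mul := by decide
  mul_one := by decide
  left_distrib := by decide
  right_distrib := by decide
  zero_mul := by decide
  mul_zero := by decide
  nsmul := nsmulRec

instance : IdemSemiring Two := IdemSemiring.ofSemiring (by decide)

instance : PreKleeneAlgebra Two where
  kstar _ := Two.one
  kstar_unfold a := by cases a <;> rfl

end Two

/-! ### Commutable sets -/

/-- A commutable set: a set endowed with a reflexive symmetric relation. -/
class CommutableSet (X : Type*) where
  comm : X → X → Prop
  comm_refl : ∀ x, comm x x
  comm_symm : ∀ x y, comm x y → comm y x

/-- The commutable set `X ⊕ Y`: left symbols commute with right symbols, and two symbols from the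
same side commute if they do so in the original set. -/
instance {X Y : Type*} [CommutableSet X] [CommutableSet Y] : CommutableSet (X ⊕ Y) where
  comm
    | Sum.inl x, Sum.inl x' => CommutableSet.comm x x'
    | Sum.inr y, Sum.inr y' => CommutableSet.comm y y'
    | Sum.inl _, Sum.inr _ => True
    | Sum.inr _, Sum.inl _ => True
  comm_refl := by
    rintro (x | y)
    · exact CommutableSet.comm_refl x
    · exact CommutableSet.comm_refl y
  comm_symm := by
    rintro (x | y) (x' | y') h
    · exact CommutableSet.comm_symm _ _ h
    · trivial
    · trivial
    · exact CommutableSet.comm_symm _ _ h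

/-! ### Strings over a commutable set -/

section Strings

variable {X Y : Type*} [CommutableSet X] [CommutableSet Y]

/-- Swapping two adjacent symbols that commute. -/
inductive Swap (X : Type*) [CommutableSet X] : FreeMonoid X → FreeMonoid X → Prop
  | swap (x y : X) (h : CommutableSet.comm x y) :
      Swap X (FreeMonoid.of x * FreeMonoid.of y) (FreeMonoid.of y * FreeMonoid.of x)

/-- The monoid of strings over `X`, where strings are equated if they can be obtained from each
other by swapping adjacent symbols that commute. -/
abbrev Str (X : Type*) [CommutableSet X] : Type _ := PresentedMonoid (Swap X)

namespace Str

/-- The one-symbol string. -/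
def of (x : X) : Str X := PresentedMonoid.of (Swap X) x

theorem of_mul_of {x y : X} (h : CommutableSet.comm x y) : of x * of y = of y * of x :=
  PresentedMonoid.mk_eq_mk_of_rel (Swap.swap x y h)

/-- The monoid morphism that extends a map on symbols. -/
def lift {M : Type*} [Monoid M] (f : X → M)
    (hf : ∀ x y, CommutableSet.comm x y → f x * f y = f y * f x) : Str X →* M :=
  PresentedMonoid.lift f (by
    rintro _ _ ⟨x, y, h⟩
    simpa using hf x y h)

/-- The length of a string. -/
def length (s : Str X) : ℕ :=
  Multiplicative.toAdd
    (lift (fun _ : X => Multiplicative.ofAdd (1 : ℕ)) (fun _ _ _ => rfl) s)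

/-- The embedding `s ↦ s_l` of strings. -/
def inl : Str X →* Str (X ⊕ Y) :=
  lift (fun x => of (Sum.inl x)) (fun _ _ h => of_mul_of h)

/-- The embedding `s ↦ s_r` of strings. -/
def inr : Str Y →* Str (X ⊕ Y) :=
  lift (fun y => of (Sum.inr y)) (fun _ _ h => of_mul_of h)

/-- The projection `π_l` on strings, which erases the right symbols. -/
def projl : Str (X ⊕ Y) →* Str X :=
  lift (Sum.elim (fun x => of x) (fun _ => 1)) (by
    rintro (x | y) (x' | y') h
    · exact of_mul_of h
    · simp
    · simp
    · simp)

/-- The projection `π_r` on strings, which erases the left symbols. -/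
def projr : Str (X ⊕ Y) →* Str Y :=
  lift (Sum.elim (fun _ => 1) (fun y => of y)) (by
    rintro (x | y) (x' | y') h
    · simp
    · simp
    · simp
    · exact of_mul_of h)

/-- `s` is a prefix of `t`. -/
def IsPrefix (s t : Str X) : Prop := ∃ u, t = s * u

end Str

end Strings

/-! ### Terms over a commutable set -/

/-- Expressions built from symbols with the operations of pre-Kleene algebra. -/
inductive PreTerm (X : Type*) : Type _
  | var (x : X)
  | zero
  | one
  | add (a b : PreTerm X)
  | mul (a b : PreTerm X)
  | star (a : PreTerm X)

/-- Provable equality of expressions: the congruence generated by the laws of pre-Kleene algebra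
and the equations `x y = y x` for the symbols `x`, `y` that commute. -/
inductive PreTerm.Eqv {X : Type*} [CommutableSet X] : PreTerm X → PreTerm X → Prop
  | refl (a) : Eqv a a
  | symm {a b} : Eqv a b → Eqv b a
  | trans {a b c} : Eqv a b → Eqv b c → Eqv a c
  | add_congr {a a' b b'} : Eqv a a' → Eqv b b' → Eqv (add a b) (add a' b')
  | mul_congr {a a' b b'} : Eqv a a' → Eqv b b' → Eqv (mul a b) (mul a' b')
  | star_congr {a a'} : Eqv a a' → Eqv (star a) (star a')
  | one_mul (a) : Eqv (mul one a) a
  | mul_one (a) : Eqv (mul a one) a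
  | zero_mul (a) : Eqv (mul zero a) zero
  | mul_zero (a) : Eqv (mul a zero) zero
  | mul_assoc (a b c) : Eqv (mul (mul a b) c) (mul a (mul b c))
  | zero_add (a) : Eqv (add zero a) a
  | add_comm (a b) : Eqv (add a b) (add b a)
  | add_assoc (a b c) : Eqv (add (add a b) c) (add a (add b c))
  | add_idem (a) : Eqv (add a a) a
  | mul_add (a b c) : Eqv (mul a (add b c)) (add (mul a b) (mul a c))
  | add_mul (a b c) : Eqv (mul (add a b) c) (add (mul a c) (mul b c))
  | star_unfold (a) : Eqv (star a) (add one (mul a (star a)))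
  | comm {x y : X} : CommutableSet.comm x y → Eqv (mul (var x) (var y)) (mul (var y) (var x))

/-- Provable equality as a setoid. -/
def PreTerm.setoid (X : Type*) [CommutableSet X] : Setoid (PreTerm X) :=
  ⟨PreTerm.Eqv, ⟨PreTerm.Eqv.refl, PreTerm.Eqv.symm, PreTerm.Eqv.trans⟩⟩

/-- The free pre-Kleene algebra over a commutable set. Its elements are called terms. -/
def Term (X : Type*) [CommutableSet X] : Type _ := Quotient (PreTerm.setoid X)

namespace Term

section Algebra

variable {X : Type*} [CommutableSet X]

/-- The term represented by an expression. -/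
def mk (a : PreTerm X) : Term X := Quotient.mk (PreTerm.setoid X) a

theorem mk_eq_mk {a b : PreTerm X} : mk a = mk b ↔ PreTerm.Eqv a b :=
  Quotient.eq (r := PreTerm.setoid X)

theorem mk_surjective : Function.Surjective (mk : PreTerm X → Term X) :=
  Quotient.exists_rep

/-- A symbol, viewed as a term. -/
def var (x : X) : Term X := mk (PreTerm.var x)

instance : Zero (Term X) := ⟨mk PreTerm.zero⟩
instance : One (Term X) := ⟨mk PreTerm.one⟩
instance : Add (Term X) :=
  ⟨Quotient.map₂ PreTerm.add fun _ _ h _ _ h' => PreTerm.Eqv.add_congr h h'⟩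
instance : Mul (Term X) :=
  ⟨Quotient.map₂ PreTerm.mul fun _ _ h _ _ h' => PreTerm.Eqv.mul_congr h h'⟩
instance : KStar (Term X) :=
  ⟨Quotient.map PreTerm.star fun _ _ h => PreTerm.Eqv.star_congr h⟩

theorem mk_zero : mk (PreTerm.zero : PreTerm X) = 0 := rfl
theorem mk_one : mk (PreTerm.one : PreTerm X) = 1 := rfl
theorem mk_add (a b : PreTerm X) : mk (PreTerm.add a b) = mk a + mk b := rfl
theorem mk_mul (a b : PreTerm X) : mk (PreTerm.mul a b) = mk a * mk b := rfl
theorem mk_star (a : PreTerm X) : mk (PreTerm.star a) = KStar.kstar (mk a) := rfl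

protected theorem zero_add' (a : Term X) : 0 + a = a := by
  obtain ⟨a, rfl⟩ := mk_surjective a
  exact mk_eq_mk.2 (PreTerm.Eqv.zero_add a)

protected theorem add_comm' (a b : Term X) : a + b = b + a := by
  obtain ⟨a, rfl⟩ := mk_surjective a
  obtain ⟨b, rfl⟩ := mk_surjective b
  exact mk_eq_mk.2 (PreTerm.Eqv.add_comm a b)

instance : Semiring (Term X) where
  add_assoc a b c := by
    obtain ⟨a, rfl⟩ := mk_surjective a
    obtain ⟨b, rfl⟩ := mk_surjective b
    obtain ⟨c, rfl⟩ := mk_surjective c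
    exact mk_eq_mk.2 (PreTerm.Eqv.add_assoc a b c)
  zero_add := Term.zero_add'
  add_zero a := by rw [Term.add_comm', Term.zero_add']
  add_comm := Term.add_comm'
  mul_assoc a b c := by
    obtain ⟨a, rfl⟩ := mk_surjective a
    obtain ⟨b, rfl⟩ := mk_surjective b
    obtain ⟨c, rfl⟩ := mk_surjective c
    exact mk_eq_mk.2 (PreTerm.Eqv.mul_assoc a b c)
  one_mul a := by
    obtain ⟨a, rfl⟩ := mk_surjective a
    exact mk_eq_mk.2 (PreTerm.Eqv.one_mul a)
  mul_one a := by
    obtain ⟨a, rfl⟩ := mk_surjective a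
    exact mk_eq_mk.2 (PreTerm.Eqv.mul_one a)
  left_distrib a b c := by
    obtain ⟨a, rfl⟩ := mk_surjective a
    obtain ⟨b, rfl⟩ := mk_surjective b
    obtain ⟨c, rfl⟩ := mk_surjective c
    exact mk_eq_mk.2 (PreTerm.Eqv.mul_add a b c)
  right_distrib a b c := by
    obtain ⟨a, rfl⟩ := mk_surjective a
    obtain ⟨b, rfl⟩ := mk_surjective b
    obtain ⟨c, rfl⟩ := mk_surjective c
    exact mk_eq_mk.2 (PreTerm.Eqv.add_mul a b c)
  zero_mul a := by
    obtain ⟨a, rfl⟩ := mk_surjective a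
    exact mk_eq_mk.2 (PreTerm.Eqv.zero_mul a)
  mul_zero a := by
    obtain ⟨a, rfl⟩ := mk_surjective a
    exact mk_eq_mk.2 (PreTerm.Eqv.mul_zero a)
  nsmul := nsmulRec

instance : IdemSemiring (Term X) :=
  IdemSemiring.ofSemiring fun a => by
    obtain ⟨a, rfl⟩ := mk_surjective a
    exact mk_eq_mk.2 (PreTerm.Eqv.add_idem a)

instance : PreKleeneAlgebra (Term X) where
  kstar := KStar.kstar
  kstar_unfold a := by
    obtain ⟨a, rfl⟩ := mk_surjective a
    exact mk_eq_mk.2 (PreTerm.Eqv.star_unfold a)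

theorem var_mul_var {x y : X} (h : CommutableSet.comm x y) : var x * var y = var y * var x :=
  mk_eq_mk.2 (PreTerm.Eqv.comm h)

end Algebra

section Lift

variable {X α : Type*} [CommutableSet X] [PreKleeneAlgebra α]

/-- Evaluation of an expression in a pre-Kleene algebra. -/
def eval (f : X → α) : PreTerm X → α
  | PreTerm.var x => f x
  | PreTerm.zero => 0
  | PreTerm.one => 1
  | PreTerm.add a b => eval f a + eval f b
  | PreTerm.mul a b => eval f a * eval f b
  | PreTerm.star a => KStar.kstar (eval f a)

theorem eval_eq {f : X → α} (hf : ∀ x y, CommutableSet.comm x y → f x * f y = f y * f x)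
    {a b : PreTerm X} (h : PreTerm.Eqv a b) : eval f a = eval f b := by
  induction h with
  | refl => rfl
  | symm _ ih => exact ih.symm
  | trans _ _ ih ih' => exact ih.trans ih'
  | add_congr _ _ ih ih' => simp only [eval, ih, ih']
  | mul_congr _ _ ih ih' => simp only [eval, ih, ih']
  | star_congr _ ih => simp only [eval, ih]
  | one_mul => exact one_mul _
  | mul_one => exact mul_one _
  | zero_mul => exact zero_mul _
  | mul_zero => exact mul_zero _
  | mul_assoc => exact mul_assoc _ _ _
  | zero_add => exact zero_add _
  | add_comm => exact add_comm _ _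
  | add_assoc => exact add_assoc _ _ _
  | add_idem => exact add_idem _
  | mul_add => exact mul_add _ _ _
  | add_mul => exact add_mul _ _ _
  | star_unfold => exact PreKleeneAlgebra.kstar_unfold _
  | comm h => exact hf _ _ h

/-- The morphism of pre-Kleene algebras that extends a map on symbols. -/
def lift (f : X → α) (hf : ∀ x y, CommutableSet.comm x y → f x * f y = f y * f x) :
    PreKleeneHom (Term X) α where
  toFun := Quotient.lift (eval f) fun _ _ h => eval_eq hf h
  map_zero' := rfl
  map_one' := rfl
  map_add' a b := by
    obtain ⟨a, rfl⟩ := mk_surjective a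
    obtain ⟨b, rfl⟩ := mk_surjective b
    rfl
  map_mul' a b := by
    obtain ⟨a, rfl⟩ := mk_surjective a
    obtain ⟨b, rfl⟩ := mk_surjective b
    rfl
  map_kstar' a := by
    obtain ⟨a, rfl⟩ := mk_surjective a
    rfl

theorem lift_var (f : X → α) (hf : ∀ x y, CommutableSet.comm x y → f x * f y = f y * f x)
    (x : X) : lift f hf (var x) = f x := rfl

end Lift

section Maps

variable {X Y : Type*} [CommutableSet X] [CommutableSet Y]

/-- A string, viewed as a term. -/
def ofStr : Str X →* Term X := Str.lift var fun _ _ h => var_mul_var h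

/-- A finite set of strings, viewed as a term (the sum of its elements). -/
noncomputable def ofFinite (S : Set (Str X)) (hS : S.Finite) : Term X :=
  ∑ s ∈ hS.toFinset, ofStr s

/-- The embedding `e ↦ e_l` of terms. -/
def inl : PreKleeneHom (Term X) (Term (X ⊕ Y)) :=
  lift (fun x => var (Sum.inl x)) (fun _ _ h => var_mul_var h)

/-- The embedding `e ↦ e_r` of terms. -/
def inr : PreKleeneHom (Term Y) (Term (X ⊕ Y)) :=
  lift (fun y => var (Sum.inr y)) (fun _ _ h => var_mul_var h)

/-- The projection `π_l` on terms, which maps the right symbols to `1`. -/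
def projl : PreKleeneHom (Term (X ⊕ Y)) (Term X) :=
  lift (Sum.elim (fun x => var x) (fun _ => 1)) (by
    rintro (x | y) (x' | y') h
    · exact var_mul_var h
    · simp
    · simp
    · simp)

/-- The projection `π_r` on terms, which maps the left symbols to `1`. -/
def projr : PreKleeneHom (Term (X ⊕ Y)) (Term Y) :=
  lift (Sum.elim (fun _ => 1) (fun y => var y)) (by
    rintro (x | y) (x' | y') h
    · simp
    · simp
    · simp
    · exact var_mul_var h)

/-- A term over `X` viewed as a term over `X ⊕ X`, by mapping each symbol `x` to `x_l x_r`. -/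
def diag : PreKleeneHom (Term X) (Term (X ⊕ X)) :=
  lift (fun x => var (Sum.inl x) * var (Sum.inr x)) (by
    intro x y h
    have hl : var (Sum.inl x : X ⊕ X) * var (Sum.inl y) = var (Sum.inl y) * var (Sum.inl x) :=
      var_mul_var h
    have hr : var (Sum.inr x : X ⊕ X) * var (Sum.inr y) = var (Sum.inr y) * var (Sum.inr x) :=
      var_mul_var h
    have hlr : ∀ a b : X, var (Sum.inr a : X ⊕ X) * var (Sum.inl b)
        = var (Sum.inl b) * var (Sum.inr a) := fun _ _ => var_mul_var trivial
    calc var (Sum.inl x : X ⊕ X) * var (Sum.inr x) * (var (Sum.inl y) * var (Sum.inr y))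
        = var (Sum.inl x) * (var (Sum.inr x) * var (Sum.inl y)) * var (Sum.inr y) := by
          simp only [mul_assoc]
      _ = (var (Sum.inl x) * var (Sum.inl y)) * (var (Sum.inr x) * var (Sum.inr y)) := by
          rw [hlr]; simp only [mul_assoc]
      _ = var (Sum.inl y) * (var (Sum.inl x) * var (Sum.inr y)) * var (Sum.inr x) := by
          rw [hl, hr]; simp only [mul_assoc]
      _ = var (Sum.inl y) * var (Sum.inr y) * (var (Sum.inl x) * var (Sum.inr x)) := by
          rw [← hlr]; simp only [mul_assoc])

/-- The morphism `[-]₀` to the booleans that maps every symbol to `0`. -/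
def constTerm : PreKleeneHom (Term X) Two :=
  lift (fun _ => 0) (fun _ _ _ => rfl)

/-- An element of the booleans, viewed as a term. -/
def ofTwo : Two → Term X
  | Two.zero => 0
  | Two.one => 1

end Maps

end Term

/-! ### Finite-state terms, bounded output, representable relations -/

section Relations

open Term

variable {X : Type*} [CommutableSet X]

/-- The family `δ` is a family of derivatives of the term `e`. -/
def IsDerivative [Fintype X] (e : Term X) (δ : X → Term X) : Prop :=
  e = ofTwo (constTerm e) + ∑ x, var x * δ x

/-- A finite-state automaton: a finite set of terms that contains `1`, and that is closed under
finite sums (including the empty one) and under derivatives. -/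
structure IsAutomaton [Fintype X] (S : Set (Term X)) : Prop where
  finite : S.Finite
  one_mem : 1 ∈ S
  zero_mem : 0 ∈ S
  add_mem : ∀ e ∈ S, ∀ e' ∈ S, e + e' ∈ S
  derivative_mem : ∀ e ∈ S, ∃ δ : X → Term X, IsDerivative e δ ∧ ∀ x, δ x ∈ S

/-- A term is finite state if it is a state of some finite-state automaton. -/
def IsFiniteState [Fintype X] (e : Term X) : Prop :=
  ∃ S : Set (Term X), IsAutomaton S ∧ e ∈ S

/-- A term is prefix free if no string below it is a proper prefix of another one. -/
def IsPrefixFree (L : Term X) : Prop :=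
  ∀ s₁ s₂ : Str X, ofStr s₁ ≤ L → ofStr s₂ ≤ L → s₁.IsPrefix s₂ → s₁ = s₂

/-- Bounded output: there is a fanout `k` with `|π_r(s)| ≤ (|π_l(s)| + 1) k` for all strings
`s ≤ e`. -/
def HasBoundedOutput (e : Term (X ⊕ X)) : Prop :=
  ∃ k : ℕ, ∀ s : Str (X ⊕ X), ofStr s ≤ e →
    (Str.projr s).length ≤ ((Str.projl s).length + 1) * k

/-- The relation `s →_e s'` on strings denoted by a term `e`. -/
def Step (e : Term (X ⊕ X)) (s s' : Str X) : Prop :=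
  ofStr (Str.inl s * Str.inr s') ≤ e

/-- The image of a set of strings under the relation denoted by `e`. -/
def Next (e : Term (X ⊕ X)) (S : Set (Str X)) : Set (Str X) :=
  {s' | ∃ s ∈ S, Step e s s'}

/-- The term `Σ^*` over `Σ ⊕ Σ`, where a symbol `x` of `Σ` stands for `x_l x_r`. -/
def sigmaStar (X : Type*) [CommutableSet X] [Fintype X] : Term (X ⊕ X) :=
  diag (KStar.kstar (∑ x : X, var x))

/-- The term `Σ^≠`, the sum of all `x_l y_r` with `x ≠ y`. -/
def sigmaNe (X : Type*) [CommutableSet X] [Fintype X] [DecidableEq X] : Term (X ⊕ X) :=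
  ∑ p : X × X with p.1 ≠ p.2, var (Sum.inl p.1) * var (Sum.inr p.2)

/-- The term `e` is a representable relation on `L`. The residue inequality ranges over the finite
sets of strings `S ≤ L`. -/
structure IsRepresentable [Fintype X] [DecidableEq X] (L : Term X) (e : Term (X ⊕ X)) :
    Prop where
  projl_le : projl e ≤ L
  projr_le : projr e ≤ L
  next_finite : ∀ S : Set (Str X), S.Finite → (Next e S).Finite
  exists_residue : ∃ ρ : Term (X ⊕ X), ∀ (S : Set (Str X)) (hS : S.Finite),
    (∀ s ∈ S, ofStr s ≤ L) →
      inr (ofFinite S hS) * e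
        ≤ diag (ofFinite S hS) * inr (ofFinite (Next e S) (next_finite S hS))
          + sigmaStar X * sigmaNe X * ρ

end Relations

end PreKA

/-! Without induction for star, an inequality such as `Λ_r e ≤ …` can only come from finitely many
unfoldings. For each string `s` of `Λ`, `e` is run as an automaton against the pending `s_r`, with
invariant: the state `q` is reached by reading `p_l t_r`, where `s = p u`, and the current term is
`p (u t)_r q`, `p` being the matched part. A right symbol extends `t`. A left symbol either cancels
against a first symbol of `u` and extends `p`, or disagrees with it and yields a mismatch `x_l y_r`,
absorbed by `Σ^* Σ^≠ ρ`. Prefix freeness of `L` settles the ends: stopping forces `p = s`, hence `t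
∈ Next_e(Λ)`, and no left symbol leading to a nonzero state can follow once `u = 1`.

Bounded output makes this terminate: each derivative lengthens `p` or `t`, while `|p| ≤ |s|` and
`|t|` is bounded as long as `q ≠ 0`. Finitely many states allow one residue `ρ` for all `Λ`. The run
is `diag_mul_inr_mul_le`; the bound is `HasBoundedOutput.exists_bound`. -/

namespace PreKA

/-! ### Strings: length, projections, commutation of the two sides -/

namespace Str

variable {X Y : Type*} [CommutableSet X] [CommutableSet Y]

@[elab_as_elim]
theorem induction_on {p : Str X → Prop} (s : Str X) (one : p 1)
    (of_mul : ∀ x s, p s → p (of x * s)) : p s := by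
  obtain ⟨l, rfl⟩ := PresentedMonoid.surjective_mk s
  induction l using FreeMonoid.inductionOn' with
  | one => exact one
  | of_mul x l ih => exact of_mul x _ ih

theorem eq_one_or_of_mul (s : Str X) : s = 1 ∨ ∃ x u, s = of x * u := by
  induction s using induction_on with
  | one => exact Or.inl rfl
  | of_mul x s _ => exact Or.inr ⟨x, s, rfl⟩

@[simp] theorem length_one : (1 : Str X).length = 0 := by simp [length]

@[simp] theorem length_mul (s t : Str X) : (s * t).length = s.length + t.length := by
  simp [length]

@[simp] theorem length_of (x : X) : (of x).length = 1 := rfl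

theorem finite_length_le [Finite X] (n : ℕ) : {s : Str X | s.length ≤ n}.Finite := by
  have h (l : FreeMonoid X) : length (PresentedMonoid.mk (Swap X) l)
      = (FreeMonoid.toList l).length := by
    induction l using FreeMonoid.inductionOn' with
    | one => simp
    | of_mul x l ih =>
      rw [map_mul, length_mul, ih, FreeMonoid.toList_of_mul, List.length_cons, add_comm]
      rfl
  refine ((List.finite_length_le X n).image
    fun l => PresentedMonoid.mk (Swap X) (FreeMonoid.ofList l)).subset fun s hs => ?_
  obtain ⟨l, rfl⟩ := PresentedMonoid.surjective_mk s
  exact ⟨l.toList, (h l).symm.trans_le hs, rfl⟩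

@[simp] theorem projl_inl (s : Str X) : projl (inl s : Str (X ⊕ Y)) = s := by
  induction s using induction_on with
  | one => simp
  | of_mul x s ih => rw [map_mul, map_mul, ih]; rfl

@[simp] theorem projl_inr (s : Str Y) : projl (inr s : Str (X ⊕ Y)) = 1 := by
  induction s using induction_on with
  | one => simp
  | of_mul x s ih => rw [map_mul, map_mul, ih, mul_one]; rfl

@[simp] theorem projr_inl (s : Str X) : projr (inl s : Str (X ⊕ Y)) = 1 := by
  induction s using induction_on with
  | one => simp
  | of_mul x s ih => rw [map_mul, map_mul, ih, mul_one]; rfl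

@[simp] theorem projr_inr (s : Str Y) : projr (inr s : Str (X ⊕ Y)) = s := by
  induction s using induction_on with
  | one => simp
  | of_mul x s ih => rw [map_mul, map_mul, ih]; rfl

theorem length_projl_le (s : Str (X ⊕ Y)) : (projl s).length ≤ s.length := by
  induction s using induction_on with
  | one => simp
  | of_mul x s ih =>
    have : (projl (of x)).length ≤ 1 := by
      cases x with
      | inl x => exact le_rfl
      | inr y => exact Nat.zero_le 1
    simp only [map_mul, length_mul, length_of]
    omega

/-- Brings a left symbol emitted by the automaton in front of the pending right string, where it can
be compared with that string's first symbol. -/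
theorem inr_commute_of_inl (x : X) (t : Str Y) :
    inr t * of (Sum.inl x) = of (Sum.inl x) * (inr t : Str (X ⊕ Y)) := by
  induction t using induction_on with
  | one => simp
  | of_mul y t ih =>
    have h : (inr (of y) : Str (X ⊕ Y)) * of (Sum.inl x) = of (Sum.inl x) * inr (of y) :=
      of_mul_of trivial
    rw [map_mul, mul_assoc, ih, ← mul_assoc, h, mul_assoc]

end Str

theorem PreKleeneHom.monotone {α β : Type*} [PreKleeneAlgebra α] [PreKleeneAlgebra β]
    (f : PreKleeneHom α β) {a b : α} (h : a ≤ b) : f a ≤ f b := by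
  rw [← add_eq_right_iff_le] at h ⊢
  rw [← map_add, h]

/-! ### Order in a pre-Kleene algebra -/

section Order

variable {α : Type*} [PreKleeneAlgebra α]

theorem one_le_kstar (a : α) : 1 ≤ KStar.kstar a := by
  rw [PreKleeneAlgebra.kstar_unfold]
  exact le_add_right le_rfl

theorem mul_kstar_le (a : α) : a * KStar.kstar a ≤ KStar.kstar a := by
  conv_rhs => rw [PreKleeneAlgebra.kstar_unfold]
  exact le_add_left le_rfl

theorem sum_le_of_forall_le {ι : Type*} (s : Finset ι) (f : ι → α) {a : α}
    (h : ∀ i ∈ s, f i ≤ a) : ∑ i ∈ s, f i ≤ a := by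
  classical
  induction s using Finset.induction_on with
  | empty => simp
  | insert i s hi ih =>
    rw [Finset.sum_insert hi]
    exact add_le (h i (Finset.mem_insert_self i s))
      (ih fun j hj => h j (Finset.mem_insert_of_mem hj))

theorem le_sum_of_mem {ι : Type*} {s : Finset ι} (f : ι → α) {i : ι} (hi : i ∈ s) :
    f i ≤ ∑ j ∈ s, f j := by
  classical
  rw [← Finset.add_sum_erase s f hi]
  exact le_add_right le_rfl

end Order

/-! ### Strings below terms -/

namespace Term

variable {X Y : Type*} [CommutableSet X] [CommutableSet Y]

theorem ofStr_of (x : X) : ofStr (Str.of x) = var x := rfl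

theorem inr_ofStr (s : Str Y) :
    inr (ofStr s) = (ofStr (Str.inr s) : Term (X ⊕ Y)) := by
  induction s using Str.induction_on with
  | one => simp
  | of_mul x s ih => simp only [map_mul, ih]; rfl

theorem projl_ofStr (s : Str (X ⊕ Y)) : projl (ofStr s) = ofStr (Str.projl s) := by
  induction s using Str.induction_on with
  | one => simp
  | of_mul x s ih =>
    simp only [map_mul, ih]
    congr 1
    cases x <;> rfl

/-- Structural induction; a star always lies above the empty string. This turns a nonzero state into
an actual string, to which bounded output and prefix freeness can be applied. -/
theorem eq_zero_or_exists_ofStr_le (a : Term X) : a = 0 ∨ ∃ s, ofStr s ≤ a := by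
  obtain ⟨a, rfl⟩ := mk_surjective a
  induction a with
  | var x => exact Or.inr ⟨Str.of x, le_rfl⟩
  | zero => exact Or.inl rfl
  | one => exact Or.inr ⟨1, le_of_eq (map_one ofStr)⟩
  | add a b iha ihb =>
    rw [mk_add]
    rcases iha with ha | ⟨s, hs⟩
    · rwa [ha, zero_add]
    · exact Or.inr ⟨s, le_add_right hs⟩
  | mul a b iha ihb =>
    rw [mk_mul]
    rcases iha with ha | ⟨s, hs⟩
    · exact Or.inl (by rw [ha, zero_mul])
    rcases ihb with hb | ⟨t, ht⟩
    · exact Or.inl (by rw [hb, mul_zero])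
    · exact Or.inr ⟨s * t, by rw [map_mul]; exact mul_le_mul' hs ht⟩
  | star a _ => exact Or.inr ⟨1, by rw [map_one, mk_star]; exact one_le_kstar _⟩

/-- One left unfolding per symbol suffices, so no induction law for star is needed. -/
theorem ofStr_le_kstar [Fintype X] (s : Str X) : ofStr s ≤ KStar.kstar (∑ x : X, var x) := by
  induction s using Str.induction_on with
  | one => rw [map_one]; exact one_le_kstar _
  | of_mul x s ih =>
    rw [map_mul, ofStr_of]
    exact (mul_le_mul' (le_sum_of_mem var (Finset.mem_univ x)) ih).trans (mul_kstar_le _)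

theorem diag_ofStr_mul_of (p : Str X) (x : X) :
    diag (ofStr (p * Str.of x))
      = diag (ofStr p) * (var (Sum.inl x) * var (Sum.inr x)) := by
  rw [map_mul, map_mul]; rfl

theorem ofStr_le_ofFinite {S : Set (Str X)} (hS : S.Finite) {s : Str X} (hs : s ∈ S) :
    ofStr s ≤ ofFinite S hS :=
  le_sum_of_mem ofStr (hS.mem_toFinset.2 hs)

end Term

open Term

/-! ### Running the automaton against a string -/

section Residue

variable {X : Type*} [CommutableSet X]

/-- The strings that can be read before reaching a state with nonempty language have an output
that is bounded linearly in their input, uniformly over a finite set of states. -/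
theorem HasBoundedOutput.exists_bound {e : Term (X ⊕ X)} (h : HasBoundedOutput e)
    {Q : Set (Term (X ⊕ X))} (hQ : Q.Finite) :
    ∃ k N : ℕ, ∀ q ∈ Q, q ≠ 0 → ∀ p t : Str X,
      ofStr (Str.inl p * Str.inr t) * q ≤ e → t.length ≤ (p.length + N + 1) * k := by
  obtain ⟨k, hk⟩ := h
  have hv : ∀ q : Term (X ⊕ X), ∃ v, q ≠ 0 → ofStr v ≤ q := fun q => by
    rcases eq_zero_or_exists_ofStr_le q with hq | ⟨v, hv⟩
    -- Dummy value: the zero state has no witness and needs none.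
    · exact ⟨1, fun h => absurd hq h⟩
    · exact ⟨v, fun _ => hv⟩
  choose v hv using hv
  -- `N` dominates the length of every chosen witness `v q`, hence the extra input needed to
  -- complete a run from `q`.
  refine ⟨k, ∑ q ∈ hQ.toFinset, (v q).length, fun q hq h0 p t hpt => ?_⟩
  have h1 := hk (Str.inl p * Str.inr t * v q) (by
    rw [map_mul]
    exact (mul_le_mul' le_rfl (hv q h0)).trans hpt)
  simp only [map_mul, Str.projr_inl, Str.projr_inr, Str.projl_inl, Str.projl_inr, one_mul,
    mul_one, Str.length_mul] at h1
  have h2 : (v q).length ≤ ∑ q ∈ hQ.toFinset, (v q).length :=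
    Finset.single_le_sum (f := fun q => (v q).length) (fun _ _ => Nat.zero_le _)
      (hQ.mem_toFinset.2 hq)
  calc t.length ≤ _ := Nat.le_of_add_right_le h1
    _ ≤ _ := Nat.mul_le_mul_right k (by have := Str.length_projl_le (v q); omega)

variable [Fintype X]

/-- The term `(p u)_r t_r q`, where the prefix `p` of the string `p u` has already been matched, is
below the successors of `p u` and the terms that exhibit a mismatch. -/
theorem diag_mul_inr_mul_le {L : Term X} {e : Term (X ⊕ X)} (hl : projl e ≤ L)
    (hL : IsPrefixFree L) {Q : Set (Term (X ⊕ X))} (hQ : IsAutomaton Q) {k N : ℕ}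
    (hb : ∀ q ∈ Q, q ≠ 0 → ∀ p t : Str X,
      ofStr (Str.inl p * Str.inr t) * q ≤ e → t.length ≤ (p.length + N + 1) * k)
    {s : Str X} (hs : ofStr s ≤ L) {R : Term (X ⊕ X)}
    (hnext : ∀ t, Step e s t → diag (ofStr s) * ofStr (Str.inr t) ≤ R)
    (hne : ∀ (p t : Str X) (x y : X), x ≠ y → ∀ q ∈ Q,
      diag (ofStr p) * (var (Sum.inl x) * var (Sum.inr y)) * (ofStr (Str.inr t) * q) ≤ R)
    (n : ℕ) (p u t : Str X) (hpu : p * u = s)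
    (hn : s.length + (s.length + N + 1) * k < p.length + t.length + n)
    (q : Term (X ⊕ X)) (hq : q ∈ Q) (hle : ofStr (Str.inl p * Str.inr t) * q ≤ e) :
    diag (ofStr p) * (ofStr (Str.inr (u * t)) * q) ≤ R := by
  induction n generalizing p u t q with
  | zero =>
    -- Out of fuel: a nonzero state would violate the output bound.
    by_cases h0 : q = 0
    · simp [h0]
    have h1 := hb q hq h0 p t hle
    have h2 : p.length ≤ s.length := by simp [← hpu]
    have h3 : (p.length + N + 1) * k ≤ (s.length + N + 1) * k :=
      Nat.mul_le_mul_right k (by omega)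
    omega
  | succ n ih =>
    obtain ⟨δ, hδ, hδQ⟩ := hQ.derivative_mem q hq
    have hδle : ∀ x, var x * δ x ≤ q := fun x => by
      rw [hδ]
      exact le_add_left (le_sum_of_mem (fun x => var x * δ x) (Finset.mem_univ x))
    -- The left projection of any completed run is a string of `L`.
    have hmem : ∀ {v}, ofStr v ≤ q → ofStr (p * Str.projl v) ≤ L := fun {v} hv => by
      have := (projl (X := X) (Y := X)).monotone ((mul_le_mul' le_rfl hv).trans hle)
      rw [← map_mul, projl_ofStr] at this
      simpa using this.trans hl
    conv_lhs => rw [hδ]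
    rw [mul_add, mul_add]
    refine add_le ?_ ?_
    · cases hc : constTerm q with
      | zero => simp [ofTwo]
      | one =>
        have h1 : ofStr (1 : Str (X ⊕ X)) ≤ q := by
          rw [hδ, hc, map_one]
          exact le_add_right le_rfl
        have hps : p = s := hL p s (by simpa using hmem h1) hs ⟨u, hpu.symm⟩
        have hu : u = 1 := by
          rcases Str.eq_one_or_of_mul u with h | ⟨x, w, rfl⟩
          · exact h
          · have := congrArg Str.length hpu
            simp [hps] at this
        subst hps hu
        rw [one_mul, ofTwo, mul_one]
        refine hnext t ((mul_one _).symm.le.trans ((mul_le_mul' le_rfl ?_).trans hle))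
        simpa using h1
    · rw [Finset.mul_sum, Finset.mul_sum]
      refine sum_le_of_forall_le _ _ fun z _ => ?_
      have hle' : ofStr (Str.inl p * Str.inr t) * (var z * δ z) ≤ e :=
        (mul_le_mul' le_rfl (hδle z)).trans hle
      rw [← mul_assoc, ← ofStr_of, ← map_mul] at hle'
      rw [← mul_assoc (ofStr _), ← ofStr_of, ← map_mul]
      cases z with
      | inr y =>
        have h1 : Str.inr t * Str.of (Sum.inr y) = (Str.inr (t * Str.of y) : Str (X ⊕ X)) := by
          rw [map_mul]; rfl
        rw [map_mul Str.inr, mul_assoc (Str.inr u), h1, ← map_mul]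
        rw [mul_assoc (Str.inl p), h1] at hle'
        exact ih p u _ hpu (by simp; omega) _ (hδQ _) hle'
      | inl x =>
        by_cases h0 : δ (Sum.inl x) = 0
        · simp [h0]
        rw [Str.inr_commute_of_inl]
        -- First symbols are not unique modulo commutation. If `x` cannot be brought to the front of
        -- `u`, any first symbol `y` of `u` differs from `x`.
        have hcase : (∃ w, u = Str.of x * w) ∨ ∃ y w, x ≠ y ∧ u = Str.of y * w := by
          by_cases hx : ∃ w, u = Str.of x * w
          · exact Or.inl hx
          rcases Str.eq_one_or_of_mul u with rfl | ⟨y, w, rfl⟩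
          -- With `u = 1`, completing the run after `x` would make `s` a proper prefix of a string
          -- of `L`.
          · obtain ⟨v, hv⟩ := (eq_zero_or_exists_ofStr_le _).resolve_left h0
            rw [mul_one] at hpu
            subst hpu
            have h1 := hmem (v := Str.of (Sum.inl x) * v) (by
              rw [map_mul, ofStr_of]
              exact (mul_le_mul' le_rfl hv).trans (hδle _))
            have h2 := congrArg Str.length (hL _ _ hs h1 ⟨_, rfl⟩)
            have h3 : (Str.projl (Str.of (Sum.inl x : X ⊕ X))).length = 1 := rfl
            simp [h3] at h2
          · refine Or.inr ⟨y, w, ?_, rfl⟩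
            rintro rfl
            exact hx ⟨w, rfl⟩
        rcases hcase with ⟨w, rfl⟩ | ⟨y, w, hxy, rfl⟩
        · have h1 : Str.inl p * Str.inr t * Str.of (Sum.inl x)
              = (Str.inl (p * Str.of x) * Str.inr t : Str (X ⊕ X)) := by
            rw [mul_assoc, Str.inr_commute_of_inl, ← mul_assoc, map_mul]; rfl
          rw [h1] at hle'
          have := ih (p * Str.of x) w t (by rw [mul_assoc, hpu]) (by simp; omega) _ (hδQ _) hle'
          rw [diag_ofStr_mul_of] at this
          refine le_of_eq_of_le ?_ this
          rw [mul_assoc (Str.of x), map_mul Str.inr, map_mul, map_mul]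
          simp only [mul_assoc]
          rfl
        · refine le_of_eq_of_le ?_ (hne p (w * t) x y hxy _ (hδQ (Sum.inl x)))
          rw [mul_assoc (Str.of y), map_mul Str.inr, map_mul, map_mul]
          simp only [mul_assoc]
          rfl

/-- Successors of `s` have length at most `(|s| + 1) k`, over a finite alphabet. -/
theorem HasBoundedOutput.next_finite {e : Term (X ⊕ X)} (h : HasBoundedOutput e)
    {S : Set (Str X)} (hS : S.Finite) : (Next e S).Finite := by
  obtain ⟨k, hk⟩ := h
  refine (hS.biUnion fun s _ => Str.finite_length_le ((s.length + 1) * k)).subset ?_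
  rintro t ⟨s, hs, hst⟩
  exact Set.mem_biUnion hs (by simpa using hk _ hst)

end Residue

end PreKA

open PreKA PreKA.Term in
theorem mainTheorem6 {A : Type*} [PreKA.CommutableSet A] [Fintype A] [DecidableEq A]
    (L : PreKA.Term A) (e : PreKA.Term (A ⊕ A))
    (hl : PreKA.Term.projl e ≤ L) (hr : PreKA.Term.projr e ≤ L)
    (hL : PreKA.IsPrefixFree L) (hfs : PreKA.IsFiniteState e)
    (hbo : PreKA.HasBoundedOutput e) :
    PreKA.IsRepresentable L e := by
  refine ⟨hl, hr, fun S hS => hbo.next_finite hS, ?_⟩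
  obtain ⟨Q, hQ, heQ⟩ := hfs
  obtain ⟨k, N, hb⟩ := hbo.exists_bound hQ.finite
  -- After a mismatch there remain an arbitrary right string and some state: `(Σ^*)_r` and the sum
  -- of all states cover both, independently of `S`.
  refine ⟨inr (KStar.kstar (∑ x : A, var x)) * ∑ q ∈ hQ.finite.toFinset, q,
    fun S hS hSL => ?_⟩
  have h : inr (ofFinite S hS) * e
      = ∑ s ∈ hS.toFinset, (ofStr (Str.inr s) : Term (A ⊕ A)) * e := by
    rw [ofFinite, map_sum, Finset.sum_mul]
    simp only [inr_ofStr]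
  rw [h]
  refine sum_le_of_forall_le _ _ fun s hs => ?_
  rw [hS.mem_toFinset] at hs
  have key := diag_mul_inr_mul_le hl hL hQ hb (hSL s hs)
    (R := diag (ofFinite S hS) * inr (ofFinite (Next e S) (hbo.next_finite hS))
      + sigmaStar A * sigmaNe A *
        (inr (KStar.kstar (∑ x : A, var x)) * ∑ q ∈ hQ.finite.toFinset, q))
    (fun t ht => le_add_right ?_) (fun p t x y hxy q hq => le_add_left ?_)
    -- Nothing is matched or output yet, so the fuel must strictly exceed the maximal `|p| + |t|`.
    (s.length + (s.length + N + 1) * k + 1) 1 s 1 (one_mul s) (by omega) e heQ (by simp)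
  · simpa using key
  · rw [← inr_ofStr]
    exact mul_le_mul' (diag.monotone (ofStr_le_ofFinite hS hs))
      (inr.monotone (ofStr_le_ofFinite _ ⟨s, hs, ht⟩))
  · rw [← inr_ofStr]
    refine mul_le_mul' (mul_le_mul' (diag.monotone (ofStr_le_kstar p)) ?_)
      (mul_le_mul' (inr.monotone (ofStr_le_kstar t)) ?_)
    · exact le_sum_of_mem
        (fun p : A × A => (var (Sum.inl p.1) * var (Sum.inr p.2) : Term (A ⊕ A)))
        (i := (x, y)) (by simpa using hxy)
    · exact le_sum_of_mem (fun q => q) (hQ.finite.mem_toFinset.2 hq)
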